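/- **Gauss sums.** Let $F$ be a nonarchimedean local field with ring of integers $\mathfrak{o}$, residue field of order $q$ and uniformizer $p$; let $n\ge 1$ with $2n\mid q-1$, let $(\cdot,\cdot)_n$ be the $n$-th power Hilbert symbol, with values in $\mu_n(F)\cong\mu_n(\mathbb{C})$ (any fixed isomorphism), and let $\psi_0:F\to\mathbb{C}^\times$ be an additive character that is trivial on $\mathfrak{o}$ but on no larger fractional ideal. With the Haar measure giving $\mathfrak{o}$ volume $1$, put $$g(a,b)=\int_{\mathfrak{o}^\times}(u,p)_n^b\,\psi_0(p^{a-b}u)\,du,\qquad g(b)=g(b-1,b),\qquad h(b)=g(b,b).$$ **Ice.** A row of ice has columns $N,\dots,0$ from left to right. Every edge carries a spin $+$ or $-$; the left edge of a row has spin $+$ and the right edge has spin $-$. Around a vertex only the six configurations (west, north, east, south) below are admissible. With spectral parameter $z$ and charge $a$ the Boltzmann weights are $$\begin{array}{l|cccccc} & {+}{+}{+}{+} & {-}{-}{-}{-} & {+}{-}{+}{-} & {-}{+}{-}{+} & {-}{+}{+}{-} & {+}{-}{-}{+}\\ \hline B^\Gamma & 1 & z & g(a) & z & h(a)z & 1\\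 B^\Delta & 1 & g(a)z & 1 & z & h(a)z & 1 \end{array}$$ where the charge $a$ of a vertex is, for $\Gamma$, the number of $+$ spins on the horizontal edges of its row to its right, and, for $\Delta$, the number of $-$ spins on the horizontal edges of its row to its left. For spin vectors $\alpha,\gamma\in\{+,-\}^{N+1}$ and two weight systems $B_1,B_2$, the two-layer system has top spins $\alpha$, bottom spins $\gamma$, weights $B_1$ in the top row and $B_2$ in the bottom row; its partition function is the sum, over all admissible choices of the remaining spins, of the product of the Boltzmann weights of all vertices. Let $\mathfrak{S}^{\Gamma\Delta}$ be this system with a $\Gamma$ row of spectral parameter $z_1$ above a $\Delta$ row of spectral parameter $z_2$, and $\mathfrak{S}^{\Delta\Gamma}$ the one with the $\Delta$ row of parameter $z_2$ above the $\Gamma$ row of parameter $z_1$, both with the same boundary spins $\alpha,\gamma$. The one-row transfer matrix $V_B$ has as entry $V_B(\alpha,\beta)$ the partition function of a single row with weights $B$, top spins $\alpha$ and bottom spins $\beta$. **Theorem 5.1.** For all $N\ge 0$, all $z_1,z_2\in\mathbb{C}$ and all $\alpha,\gamma\in\{+,-\}^{N+1}$, $$Z(\mathfrak{S}^{\Gamma\Delta})=Z(\mathfrak{S}^{\Delta\Gamma}).$$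 In other words, the transfer matrices commute: $V_{B^\Gamma_{z_1}}V_{B^\Delta_{z_2}}=V_{B^\Delta_{z_2}}V_{B^\Gamma_{z_1}}$. -/

import Mathlib

/-! ## Gauss sums on a nonarchimedean local field -/

namespace MetaplecticIce

open ValuativeRel MeasureTheory

noncomputable section LocalField

variable (F : Type*) [Field F] [ValuativeRel F] [TopologicalSpace F]
  [IsNonarchimedeanLocalField F]

/-- The normalized additive valuation of a nonzero element of a nonarchimedean local field: it is
surjective onto `ℤ`, and it is nonnegative exactly on the nonzero integers. (Junk: `ord 0 = 0`.) -/
def ord (x : F) : ℤ :=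
  -WithZero.log (IsNonarchimedeanLocalField.valueGroupWithZeroIsoInt F (valuation F x))

variable {F}

/-- The unit `(-1)^(ord a * ord b) * a^(ord b) / b^(ord a)` attached to nonzero `a` and `b`. -/
def tameUnit (a b : F) : F :=
  (-1) ^ (ord F a * ord F b) * a ^ ord F b / b ^ ord F a

/-- The `n`-th power Hilbert symbol `(a, b)_n` of a nonarchimedean local field whose residue field
has `q` elements, where `n ∣ q - 1`: the unique `n`-th root of unity of `F` that is congruent to
`tameUnit a b ^ ((q - 1) / n)` modulo the maximal ideal. -/
def hilbertSymbol (n : ℕ) (a b : F) : rootsOfUnity n F :=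
  Classical.epsilon fun ζ : rootsOfUnity n F =>
    valuation F (((ζ : Fˣ) : F) - tameUnit a b ^ ((Nat.card 𝓀[F] - 1) / n)) < 1

variable (F) in
/-- The ring of integers as a compact set with nonempty interior. -/
def integersPositiveCompacts : TopologicalSpace.PositiveCompacts F where
  carrier := {x : F | valuation F x ≤ 1}
  isCompact' := IsNonarchimedeanLocalField.isCompact_closedBall F 1
  interior_nonempty' := by
    have h : IsOpen {x : F | valuation F x ≤ 1} := by
      simpa [Valuation.restrict_le_one_iff] using
        Valuation.isOpen_closedBall (v := valuation F) one_ne_zero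
    exact ⟨0, by rw [h.interior_eq]; simp⟩

variable [MeasurableSpace F] [BorelSpace F]

variable (F) in
/-- The additive Haar measure for which the ring of integers has measure `1`. -/
def haar : Measure F := Measure.addHaarMeasure (integersPositiveCompacts F)

/-- The Gauss sum `g(a, b)`: the integral over the units `u` of the ring of integers of
`(u, p)_n ^ b * ψ₀ (p ^ (a - b) * u)`. Here `ε` identifies the `n`-th roots of unity of `F` with
the complex ones. -/
def gauss (n : ℕ) (ε : rootsOfUnity n F ≃* rootsOfUnity n ℂ) (ψ₀ : AddChar F ℂ) (p : F)
    (a b : ℤ) : ℂ :=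
  ∫ u in {u : F | valuation F u = 1},
    ((ε (hilbertSymbol n u p) : ℂˣ) : ℂ) ^ b * ψ₀ (p ^ (a - b) * u) ∂(haar F)

/-- `g(b) = g(b - 1, b)`. -/
def gaussG (n : ℕ) (ε : rootsOfUnity n F ≃* rootsOfUnity n ℂ) (ψ₀ : AddChar F ℂ) (p : F)
    (b : ℕ) : ℂ :=
  gauss n ε ψ₀ p ((b : ℤ) - 1) b

/-- `h(b) = g(b, b)`. -/
def gaussH (n : ℕ) (ε : rootsOfUnity n F ≃* rootsOfUnity n ℂ) (ψ₀ : AddChar F ℂ) (p : F)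
    (b : ℕ) : ℂ :=
  gauss n ε ψ₀ p b b

end LocalField

/-! ## Ice -/

/-- The spin of an edge. -/
inductive Spin
  | plus
  | minus
  deriving DecidableEq

open Spin

instance : Fintype Spin where
  elems := {plus, minus}
  complete := by intro x; cases x <;> simp

/-- The six admissible configurations `(west, north, east, south)` around a vertex, in the order
`a₁, a₂, b₁, b₂, c₁, c₂`. -/
def admissibleVertices : Finset (Spin × Spin × Spin × Spin) :=
  {(plus, plus, plus, plus), (minus, minus, minus, minus),
   (plus, minus, plus, minus), (minus, plus, minus, plus),
   (minus, plus, plus, minus), (plus, minus, minus, plus)}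

/-- Boltzmann weight of Gamma ice at a vertex with charge `a`, spectral parameter `z` and spins
`west north east south`. The last line concerns only inadmissible vertices. -/
def gammaWeight (g h : ℕ → ℂ) (z : ℂ) (a : ℕ) : Spin → Spin → Spin → Spin → ℂ
  | plus, plus, plus, plus => 1
  | minus, minus, minus, minus => z
  | plus, minus, plus, minus => g a
  | minus, plus, minus, plus => z
  | minus, plus, plus, minus => h a * z
  | plus, minus, minus, plus => 1
  | _, _, _, _ => 0

/-- Boltzmann weight of Delta ice at a vertex with charge `a`, spectral parameter `z` and spins
`west north east south`. The last line concerns only inadmissible vertices. -/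
def deltaWeight (g h : ℕ → ℂ) (z : ℂ) (a : ℕ) : Spin → Spin → Spin → Spin → ℂ
  | plus, plus, plus, plus => 1
  | minus, minus, minus, minus => g a * z
  | plus, minus, plus, minus => 1
  | minus, plus, minus, plus => z
  | minus, plus, plus, minus => h a * z
  | plus, minus, minus, plus => 1
  | _, _, _, _ => 0

/-- Vertical spins along one line of vertical edges. The columns are labelled `0, …, N` from right
to left. -/
abbrev ColSpins (N : ℕ) : Type := Fin (N + 1) → Spin

/-- Spins of the `N + 2` horizontal edges of one row, numbered from right to left: edge `0` is the
right boundary edge, edge `N + 1` is the left boundary edge, and the vertex in column `j` has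
edge `j` to its east and edge `j + 1` to its west. -/
abbrev RowSpins (N : ℕ) : Type := Fin (N + 2) → Spin

variable {N : ℕ}

/-- Charge in Gamma ice: the number of `+` spins in the row to the right of column `j`. -/
def gammaCharge (e : RowSpins N) (j : Fin (N + 1)) : ℕ :=
  (Finset.univ.filter fun k : Fin (N + 2) => k ≤ j.castSucc ∧ e k = plus).card

/-- Charge in Delta ice: the number of `-` spins in the row to the left of column `j`. -/
def deltaCharge (e : RowSpins N) (j : Fin (N + 1)) : ℕ :=
  (Finset.univ.filter fun k : Fin (N + 2) => j.succ ≤ k ∧ e k = minus).card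

/-- An assignment of Boltzmann weights to the vertices of a row, as a function of the spins above
the row, the horizontal spins of the row, the spins below the row, and the column. -/
abbrev RowBoltzmann (N : ℕ) : Type := ColSpins N → RowSpins N → ColSpins N → Fin (N + 1) → ℂ

/-- Gamma ice with spectral parameter `z`. -/
def gammaIce (g h : ℕ → ℂ) (z : ℂ) : RowBoltzmann N := fun α e β j =>
  gammaWeight g h z (gammaCharge e j) (e j.succ) (α j) (e j.castSucc) (β j)

/-- Delta ice with spectral parameter `z`. -/
def deltaIce (g h : ℕ → ℂ) (z : ℂ) : RowBoltzmann N := fun α e β j =>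
  deltaWeight g h z (deltaCharge e j) (e j.succ) (α j) (e j.castSucc) (β j)

/-- The horizontal spins `e` complete the vertical spins `α` (above) and `β` (below) to an
admissible row with `+` at the left edge and `-` at the right edge. -/
def IsRowState (α : ColSpins N) (e : RowSpins N) (β : ColSpins N) : Prop :=
  e (Fin.last (N + 1)) = plus ∧ e 0 = minus ∧
    ∀ j : Fin (N + 1), (e j.succ, α j, e j.castSucc, β j) ∈ admissibleVertices

instance (α : ColSpins N) (e : RowSpins N) (β : ColSpins N) : Decidable (IsRowState α e β) := by
  unfold IsRowState; infer_instance

/-- The transfer matrix of a row: its entry at `(α, β)` is the partition function of the one-layer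
system with top spins `α` and bottom spins `β`. -/
def transferMatrix (B : RowBoltzmann N) : Matrix (ColSpins N) (ColSpins N) ℂ := fun α β =>
  ∑ e : RowSpins N with IsRowState α e β, ∏ j, B α e β j

/-- The interior and lateral spins of a two-layer system: the horizontal spins of the top row, the
vertical spins between the rows, and the horizontal spins of the bottom row. -/
abbrev TwoLayerSpins (N : ℕ) : Type := RowSpins N × ColSpins N × RowSpins N

/-- The partition function of the two-layer system with top spins `α`, bottom spins `γ`, weights
`B₁` in the top row and `B₂` in the bottom row: the sum over all admissible states of the product
of the Boltzmann weights of all vertices. -/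
def twoLayerZ (B₁ B₂ : RowBoltzmann N) (α γ : ColSpins N) : ℂ :=
  ∑ s : TwoLayerSpins N with IsRowState α s.1 s.2.1 ∧ IsRowState s.2.1 s.2.2 γ,
    (∏ j, B₁ α s.1 s.2.1 j) * ∏ j, B₂ s.2.1 s.2.2 γ j

end MetaplecticIce

open MetaplecticIce
open scoped ValuativeRel nonZeroDivisors

/-!
The two orders of a Gamma row and a Delta row are compared by a Yang–Baxter equation and the train
argument.

The Boltzmann weights depend on charges, which are not local data. They become local when edges
remember their charge modulo `n`. Since `h(a) = 0` unless `n ∣ a`, in a Gamma row of nonzero weight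
every `-` edge has charge `0` mod `n`, so the states of a Gamma edge are `-` and `+` with a charge
in `ℤ/n`; dually the states of a Delta edge are `+` and `-` with a charge in `ℤ/n`. A row is then a
product of one matrix per column (`gammaSum_eq_colProd`, `deltaSum_eq_colProd`), and two
superposed rows are a product of one matrix per column on pairs of edge states.

On these pairs there is an explicit matrix `rMatrix` which intertwines the column of Gamma over
Delta with the column of Delta over Gamma, for all spins above and below (`yangBaxter`). It is
diagonal off the pairs `(+, -)` with charges `a + b = 1` and `(-, +)`, on which it is a full
`(n + 1) × (n + 1)` block. Verifying the equation uses only `g(0) = -v` and `g(a) g(-a) = v` for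
`a ≠ 0`, where `v = 1/q`. Carrying the matrix through all columns, and using that it acts by the
same scalar `v z₂ⁿ - z₁ⁿ` on the pairs at the left boundary and on those at the right boundary,
gives the equality of partition functions up to that scalar; continuity in `z₁` removes it.

The arithmetic input is the reduction of the integrals `g` and `h` to sums over the residue field
(`setIntegral_units`). For a unit `u`, the symbol `(u, p)_n` is an `n`-th power residue character
of exact order `n` in the residue of `u` (`coe_hilbertSymbol`). The lift of roots of unity from
the residue field needs no Hensel lemma: reduction is injective on `n`-th roots of unity, and `F`
has `n` of them because `μ_n(F) ≃ μ_n(ℂ)`. The product formula for Gauss sums over a finite field,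
with `(-1, p)_n = 1` because `2n ∣ q - 1`, then gives `g(a) g(-a) = 1/q`.
-/

namespace MetaplecticIce

open Spin ValuativeRel MeasureTheory IsLocalRing
open scoped Kronecker nonZeroDivisors

/-! ### The column matrices and the R-matrix -/

section yangBaxter

lemma sum_spin {M : Type*} [AddCommMonoid M] (f : Spin → M) : ∑ s, f s = f plus + f minus := by
  have : (Finset.univ : Finset Spin) = {plus, minus} := rfl
  rw [this, Finset.sum_pair (by decide)]

variable {n : ℕ}

/-- Gamma weight at a vertex with given north and south spins, as a matrix in its west and east
edge states. The state `none` is the spin `-`; the state `some a` is the spin `+` when there are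
`a` mod `n` spins `+` on the edges of the row from this one rightwards, this one included. -/
def gammaVertex (g : ZMod n → ℂ) (v z : ℂ) :
    Spin → Spin → Matrix (Option (ZMod n)) (Option (ZMod n)) ℂ
  | plus, plus, none, none => z
  | minus, minus, none, none => z
  | plus, minus, none, some a => if a = 0 then (1 - v) * z else 0
  | minus, plus, some a, none => if a = 1 then 1 else 0
  | plus, plus, some a, some b => if a = b + 1 then 1 else 0
  | minus, minus, some a, some b => if a = b + 1 then g b else 0
  | _, _, _, _ => 0

/-- Delta weight at a vertex with given north and south spins, as a matrix in its west and east
edge states. The state `none` is the spin `+`; the state `some b` is the spin `-` when there are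
`b` mod `n` spins `-` on the edges of the row from this one leftwards, this one included. -/
def deltaVertex (g : ZMod n → ℂ) (v z : ℂ) :
    Spin → Spin → Matrix (Option (ZMod n)) (Option (ZMod n)) ℂ
  | plus, plus, none, none => 1
  | minus, minus, none, none => 1
  | minus, plus, none, some b => if b = 1 then 1 else 0
  | plus, minus, some b, none => if b = 0 then (1 - v) * z else 0
  | plus, plus, some b, some c => if b + 1 = c then z else 0
  | minus, minus, some b, some c => if b + 1 = c then g b * z else 0
  | _, _, _, _ => 0

/-- The state of a Gamma edge (first component) and the Delta edge in the same position. -/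
abbrev PairState (n : ℕ) : Type := Option (ZMod n) × Option (ZMod n)

/-- A column with a Gamma vertex above a Delta vertex, summed over the spin between them. -/
def gammaDeltaColumn (g : ZMod n → ℂ) (v z₁ z₂ : ℂ) (α γ : Spin) :
    Matrix (PairState n) (PairState n) ℂ :=
  ∑ β, gammaVertex g v z₁ α β ⊗ₖ deltaVertex g v z₂ β γ

/-- A column with a Delta vertex above a Gamma vertex, summed over the spin between them. The edge
states stay in the order Gamma, Delta. -/
def deltaGammaColumn (g : ZMod n → ℂ) (v z₁ z₂ : ℂ) (α γ : Spin) :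
    Matrix (PairState n) (PairState n) ℂ :=
  ∑ β, gammaVertex g v z₁ β γ ⊗ₖ deltaVertex g v z₂ α β

/-- The representative in `{1, …, n}` of a class modulo `n`. -/
def chargeRep (a : ZMod n) : ℕ := (a - 1).val + 1

/-- The scalar by which the R-matrix acts on the states of both lateral boundaries. -/
def boundaryScalar (n : ℕ) (v z₁ z₂ : ℂ) : ℂ := v * z₂ ^ n - z₁ ^ n

/-- The monomial `x ^ i * y ^ (n - i)`, where `i` is the representative of `a` in `{1, …, n}`. -/
def cyclicMonomial (x y : ℂ) (a : ZMod n) : ℂ := x ^ chargeRep a * y ^ (n - chargeRep a)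

/-- The entries of the R-matrix between states `(+, -)` whose charges add up to `1`; such a state
is determined by its Gamma charge. -/
def chargeExchange (v z₁ z₂ : ℂ) (a b : ZMod n) : ℂ :=
  if a = b then z₁ ^ n - v ^ 2 * z₂ ^ n
  else if chargeRep b < chargeRep a then
    (1 - v) * (z₁ ^ (n - (chargeRep a - chargeRep b)) * z₂ ^ (chargeRep a - chargeRep b))
  else (1 - v) * v * (z₁ ^ (chargeRep b - chargeRep a) * z₂ ^ (n - (chargeRep b - chargeRep a)))

/-- The R-matrix of a Gamma and a Delta line, normalized to have polynomial entries. -/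
def rMatrix (g : ZMod n → ℂ) (v z₁ z₂ : ℂ) : Matrix (PairState n) (PairState n) ℂ
  | (none, none), (none, none) => z₂ ^ n - z₁ ^ n
  | (none, none), (some a, some b) => if a + b = 1 then (v - 1) * cyclicMonomial z₁ z₂ a else 0
  | (some a, some b), (none, none) => if a + b = 1 then (v - 1) * cyclicMonomial z₂ z₁ a else 0
  | (some a, none), (some a', none) => if a = a' then boundaryScalar n v z₁ z₂ else 0
  | (none, some b), (none, some b') => if b = b' then boundaryScalar n v z₁ z₂ else 0
  | (some a, some b), (some a', some b') =>
      if a + b = 1 then (if a' + b' = 1 then chargeExchange v z₁ z₂ a a' else 0)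
      else if a = a' ∧ b = b' then boundaryScalar n v z₁ z₂ * g (a + b - 1) else 0
  | _, _ => 0

variable [NeZero n]

/-! ### The Yang–Baxter equation -/

lemma chargeRep_zero : chargeRep (0 : ZMod n) = n := by
  obtain ⟨m, rfl⟩ := Nat.exists_eq_succ_of_ne_zero (NeZero.ne n)
  simp [chargeRep, ZMod.val_neg_one]

lemma chargeRep_add_one {a : ZMod n} (ha : a ≠ 0) : chargeRep (a + 1) = chargeRep a + 1 := by
  have h : (a - 1).val + 1 < n := by
    refine lt_of_le_of_ne (ZMod.val_lt _) fun h => ha ?_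
    have := congrArg (Nat.cast : ℕ → ZMod n) h
    simpa using this
  rcases Nat.lt_or_ge 1 n with h1 | h1
  · have : Fact (1 < n) := ⟨h1⟩
    have h2 := ZMod.val_add_of_lt (a := a - 1) (b := 1) (by simpa [ZMod.val_one n] using h)
    simp only [sub_add_cancel, ZMod.val_one n] at h2
    simp [chargeRep, h2]
  · omega

omit [NeZero n] in
lemma chargeRep_one : chargeRep (1 : ZMod n) = 1 := by simp [chargeRep]

lemma chargeRep_le (a : ZMod n) : chargeRep a ≤ n := ZMod.val_lt _

omit [NeZero n] in
lemma one_le_chargeRep (a : ZMod n) : 1 ≤ chargeRep a := Nat.le_add_left _ _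

lemma chargeRep_lt {a : ZMod n} (ha : a ≠ 0) : chargeRep a < n := by
  have := chargeRep_le (a + 1)
  rw [chargeRep_add_one ha] at this
  exact this

lemma cyclicMonomial_zero (x y : ℂ) : cyclicMonomial x y (0 : ZMod n) = x ^ n := by
  simp [cyclicMonomial, chargeRep_zero]

lemma mul_cyclicMonomial_one (x y : ℂ) : y * cyclicMonomial x y (1 : ZMod n) = x * y ^ n := by
  obtain ⟨m, rfl⟩ := Nat.exists_eq_succ_of_ne_zero (NeZero.ne n)
  simp [cyclicMonomial, chargeRep_one]
  ring

lemma mul_cyclicMonomial_add_one (x y : ℂ) {a : ZMod n} (ha : a ≠ 0) :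
    y * cyclicMonomial x y (a + 1) = x * cyclicMonomial x y a := by
  have h := chargeRep_lt ha
  obtain ⟨k, hk⟩ := Nat.exists_eq_add_of_lt h
  rw [cyclicMonomial, cyclicMonomial, chargeRep_add_one ha, show n - chargeRep a = k + 1 by omega,
    show n - (chargeRep a + 1) = k by omega]
  ring

section
variable (v z₁ z₂ : ℂ)

omit [NeZero n] in
lemma chargeExchange_self (a : ZMod n) : chargeExchange v z₁ z₂ a a = z₁ ^ n - v ^ 2 * z₂ ^ n := by
  simp [chargeExchange]

lemma chargeExchange_zero_left {a : ZMod n} (ha : a ≠ 0) :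
    chargeExchange v z₁ z₂ 0 a = (1 - v) * cyclicMonomial z₁ z₂ a := by
  have h := chargeRep_lt ha
  rw [chargeExchange, if_neg ha.symm, chargeRep_zero, if_pos h, cyclicMonomial,
    Nat.sub_sub_self h.le]

lemma chargeExchange_zero_right {a : ZMod n} (ha : a ≠ 0) :
    chargeExchange v z₁ z₂ a 0 = (1 - v) * v * cyclicMonomial z₂ z₁ a := by
  have h := chargeRep_lt ha
  rw [chargeExchange, if_neg ha, chargeRep_zero, if_neg h.le.not_gt, cyclicMonomial,
    Nat.sub_sub_self h.le]
  ring

lemma chargeExchange_one_left {a : ZMod n} (ha : a ≠ 0) :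
    chargeExchange v z₁ z₂ 1 (a + 1) = (1 - v) * v * cyclicMonomial z₁ z₂ a := by
  have h := one_le_chargeRep a
  rw [chargeExchange, if_neg (by simpa using ha), chargeRep_one, chargeRep_add_one ha,
    if_neg (by omega), cyclicMonomial, Nat.add_sub_cancel]

lemma chargeExchange_one_right {a : ZMod n} (ha : a ≠ 0) :
    chargeExchange v z₁ z₂ (a + 1) 1 = (1 - v) * cyclicMonomial z₂ z₁ a := by
  have h := one_le_chargeRep a
  rw [chargeExchange, if_neg (by simpa using ha), chargeRep_one, chargeRep_add_one ha,
    if_pos (by omega), cyclicMonomial, Nat.add_sub_cancel]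
  ring

lemma chargeExchange_add_one {a b : ZMod n} (ha : a ≠ 0) (hb : b ≠ 0) :
    chargeExchange v z₁ z₂ (a + 1) (b + 1) = chargeExchange v z₁ z₂ a b := by
  simp [chargeExchange, chargeRep_add_one ha, chargeRep_add_one hb]
end

/-- The Yang–Baxter equation: the R-matrix can be moved from the west to the east of a column,
exchanging the two rows. -/
theorem yangBaxter (g : ZMod n → ℂ) (v z₁ z₂ : ℂ) (hg0 : g 0 = -v)
    (hg : ∀ a, a ≠ 0 → g a * g (-a) = v) (α γ : Spin) :
    rMatrix g v z₁ z₂ * gammaDeltaColumn g v z₁ z₂ α γ =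
      deltaGammaColumn g v z₁ z₂ α γ * rMatrix g v z₁ z₂ := by
  have P0 := cyclicMonomial_zero (n := n) z₁ z₂
  have P0' := cyclicMonomial_zero (n := n) z₂ z₁
  have P1 := mul_cyclicMonomial_one (n := n) z₁ z₂
  have P1' := mul_cyclicMonomial_one (n := n) z₂ z₁
  ext ⟨w₁, w₂⟩ ⟨e₁, e₂⟩
  -- Charges increase by one across the column: shifting the outer charges makes both sides match.
  obtain ⟨w₁, rfl⟩ : ∃ x, w₁ = Option.map (· + 1) x := ⟨w₁.map (· - 1), by simp [Function.comp_def]⟩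
  obtain ⟨e₂, rfl⟩ : ∃ x, e₂ = Option.map (· + 1) x := ⟨e₂.map (· - 1), by simp [Function.comp_def]⟩
  simp only [Matrix.mul_apply, gammaDeltaColumn, deltaGammaColumn, Fintype.sum_prod_type,
    sum_spin, Matrix.add_apply, Matrix.kronecker_apply, Fintype.sum_option]
  rcases w₁ with _ | a <;> rcases w₂ with _ | b <;> rcases e₁ with _ | c <;>
    rcases e₂ with _ | d <;> cases α <;> cases γ <;>
    simp only [gammaVertex, deltaVertex, mul_zero, zero_mul, add_zero, zero_add,
      Finset.sum_const_zero, mul_ite, ite_mul, mul_one, one_mul, Finset.sum_add_distrib,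
      Finset.sum_ite_eq, Finset.sum_ite_eq', Finset.mem_univ, if_true, Option.map_none,
      Option.map_some, add_left_inj]
  all_goals simp [rMatrix, boundaryScalar, ← add_assoc, add_right_comm _ (1 : ZMod n)]
  -- After the shift, a state `(+, -)` lies in the full block of the R-matrix when its charges add
  -- up to `0`. Charge `0` is separate in these cases: it is where the cyclic monomials wrap around
  -- and where the value `g 0 = -v` enters instead of the product relation.
  case none.none.none.none.plus.plus => ring
  case none.none.none.none.minus.minus =>
    rw [P0']
    linear_combination (v - 1) * (1 - v) * P1
  case none.none.none.some.minus.plus =>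
    split_ifs
    · linear_combination (v - 1) * P1
    · ring
  case none.none.some.none.plus.minus =>
    rcases eq_or_ne c 0 with rfl | hc
    · simp only [zero_add, if_true]
      linear_combination (v - 1) * (1 - v) * P1
    · simp [hc, hc.symm]
  case none.none.some.some.plus.plus =>
    by_cases h : c + d = 0
    · obtain rfl := eq_neg_of_add_eq_zero_right h
      rcases eq_or_ne c 0 with rfl | hc
      · simp [P0]
        linear_combination (v - 1) * P1
      · simp [hc]
        linear_combination (v - 1) * mul_cyclicMonomial_add_one z₁ z₂ hc
    · split_ifs <;> simp_all
  case none.none.some.some.minus.minus =>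
    split_ifs with h
    · obtain rfl := eq_neg_of_add_eq_zero_right h
      rcases eq_or_ne c 0 with rfl | hc
      · simp [P0, chargeExchange_self, hg0]
        linear_combination (v - 1) * v ^ 2 * P1
      · rw [chargeExchange_zero_left v z₁ z₂ hc]
        linear_combination (v - 1) * v * mul_cyclicMonomial_add_one z₁ z₂ hc +
          (v - 1) * cyclicMonomial z₁ z₂ (c + 1) * z₂ * hg c hc
    · ring
  case none.some.none.none.plus.minus =>
    rw [P0']
    split_ifs <;> ring
  case none.some.none.some.plus.plus => split_ifs <;> ring
  case none.some.none.some.minus.minus =>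
    split_ifs with h
    · rw [h]
      ring
    · rfl
  case none.some.some.some.plus.minus =>
    rcases eq_or_ne b 0 with rfl | hb
    · rcases eq_or_ne c 0 with rfl | hc
      · rcases eq_or_ne d 0 with rfl | hd
        · simp [P0, chargeExchange_self, hg0]
          ring
        · simp [hd, hd.symm]
      · simp only [hc, if_false, if_true, chargeExchange_zero_left v z₁ z₂ hc]
        split_ifs <;> ring
    · rcases eq_or_ne c 0 with rfl | hc
      · simp only [hb, if_true, if_false, true_and, zero_add]
        split_ifs with h
        · rw [h]
          ring
        · rfl
      · simp [hb, hc, hc.symm]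
  case some.none.none.none.minus.plus =>
    rcases eq_or_ne a 0 with rfl | ha
    · simp [P0']
      ring
    · simp [ha]
  case some.none.some.none.minus.minus =>
    split_ifs with h
    · rw [h]
      ring
    · rfl
  case some.none.some.some.minus.plus =>
    rcases eq_or_ne a 0 with rfl | ha
    · rcases eq_or_ne c 0 with rfl | hc
      · rcases eq_or_ne d 0 with rfl | hd
        · simp [P0, chargeExchange_self, hg0]
          ring
        · simp [hd]
      · simp only [hc.symm, if_false, if_true, chargeExchange_zero_left v z₁ z₂ hc]
        split_ifs <;> ring
    · simp only [ha, if_false, zero_add]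
      split_ifs <;> simp_all
  case some.some.none.none.plus.plus =>
    by_cases h : a + b = 0
    · obtain rfl := eq_neg_of_add_eq_zero_right h
      rcases eq_or_ne a 0 with rfl | ha
      · simp [P0']
        linear_combination (v - 1) * P1'
      · simp [ha]
        linear_combination (v - 1) * mul_cyclicMonomial_add_one z₂ z₁ ha
    · split_ifs <;> simp_all
  case some.some.none.none.minus.minus =>
    by_cases h : a + b = 0
    · obtain rfl := eq_neg_of_add_eq_zero_right h
      rcases eq_or_ne a 0 with rfl | ha
      · simp [P0', hg0, chargeExchange_self]
        linear_combination (v - 1) * P1'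
      · simp only [h, if_true, chargeExchange_one_right v z₁ z₂ ha]
        linear_combination (v - 1) * mul_cyclicMonomial_add_one z₂ z₁ ha -
          z₂ * (v - 1) * cyclicMonomial z₂ z₁ a * hg a ha
    · have : ¬ (a = 0 ∧ b = 0) := fun h' => h (by simp [h'])
      simp [h, this]
  case some.some.none.some.minus.plus =>
    by_cases h : a + b = 0
    · obtain rfl := eq_neg_of_add_eq_zero_right h
      rcases eq_or_ne a 0 with rfl | ha
      · rcases eq_or_ne d 0 with rfl | hd
        · simp [hg0, chargeExchange_self]
          linear_combination (v - 1) * P1'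
        · simp [hd, hd.symm]
      · simp only [h, if_true, chargeExchange_one_right v z₁ z₂ ha, ha, if_false]
        split_ifs
        · linear_combination (v - 1) * mul_cyclicMonomial_add_one z₂ z₁ ha
        · ring
    · split_ifs <;> simp_all
      ring
  case some.some.some.none.plus.minus =>
    by_cases h : a + b = 0
    · obtain rfl := eq_neg_of_add_eq_zero_right h
      rcases eq_or_ne a 0 with rfl | ha
      · rcases eq_or_ne c 0 with rfl | hc
        · simp [hg0, chargeExchange_self]
          linear_combination (v - 1) * (1 - v) * P1'
        · simp [hc, hc.symm]
      · rcases eq_or_ne c 0 with rfl | hc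
        · simp only [h, if_true, zero_add, chargeExchange_one_right v z₁ z₂ ha, ha,
            neg_eq_zero, if_false]
          linear_combination (v - 1) * (1 - v) * mul_cyclicMonomial_add_one z₂ z₁ ha
        · simp [h, hc, ha]
    · split_ifs <;> simp_all
      ring
  case some.some.some.some.plus.plus =>
    by_cases h : a + b = 0
    · obtain rfl := eq_neg_of_add_eq_zero_right h
      by_cases h' : c + d = 0
      · obtain rfl := eq_neg_of_add_eq_zero_right h'
        rcases eq_or_ne a 0 with rfl | ha
        · rcases eq_or_ne c 0 with rfl | hc
          · simp [chargeExchange_self, P0]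
            linear_combination (v - 1) * (1 - v) * P1'
          · simp [hc, chargeExchange_one_left v z₁ z₂ hc, chargeExchange_zero_left v z₁ z₂ hc]
            ring
        · rcases eq_or_ne c 0 with rfl | hc
          · simp [ha, chargeExchange_one_right v z₁ z₂ ha, chargeExchange_zero_right v z₁ z₂ ha]
            linear_combination (v - 1) * (1 - v) * mul_cyclicMonomial_add_one z₂ z₁ ha
          · simp [hc, ha, chargeExchange_add_one v z₁ z₂ ha hc]
            ring
      · have : ¬ (d = 0 ∧ c = 0) := fun h'' => h' (by simp [h''])
        simp [h', ← ite_and, this]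
    · have : ¬ (d = 0 ∧ c = 0 ∧ a + b = 0) := fun h'' => h h''.2.2
      simp only [h, if_false, ← ite_and]
      split_ifs <;> simp_all
      ring
  case some.some.some.some.minus.minus =>
    by_cases h : a + b = 0
    · obtain rfl := eq_neg_of_add_eq_zero_right h
      by_cases h' : c + d = 0
      · obtain rfl := eq_neg_of_add_eq_zero_right h'
        rcases eq_or_ne a 0 with rfl | ha
        · rcases eq_or_ne c 0 with rfl | hc
          · simp [hg0, chargeExchange_self]
            ring
          · simp [chargeExchange_one_left v z₁ z₂ hc, chargeExchange_zero_left v z₁ z₂ hc, hg0]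
            linear_combination (1 - v) * v * cyclicMonomial z₁ z₂ c * z₂ * hg c hc
        · rcases eq_or_ne c 0 with rfl | hc
          · simp [chargeExchange_one_right v z₁ z₂ ha, chargeExchange_zero_right v z₁ z₂ ha, hg0]
            linear_combination -(1 - v) * v * cyclicMonomial z₂ z₁ a * z₂ * hg a ha
          · simp [chargeExchange_add_one v z₁ z₂ ha hc]
            linear_combination chargeExchange v z₁ z₂ a c * z₂ * (hg c hc - hg a ha)
      · simp [h']
    · simp only [h, if_false]
      split_ifs with h'
      · rw [h'.1, h'.2]
        ring
      · rfl

end yangBaxter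

/-! ### Partition functions as matrix products over the columns -/

section rows

/-- Product of matrices attached to the columns `0, …, k - 1`, with column `0` rightmost. -/
def colProd {S : Type*} [Fintype S] [DecidableEq S] {k : ℕ} (f : Fin k → Matrix S S ℂ) :
    Matrix S S ℂ :=
  (List.ofFn f).reverse.prod

section colProd
variable {S : Type*} [Fintype S] [DecidableEq S] {k : ℕ}

lemma colProd_zero (f : Fin 0 → Matrix S S ℂ) : colProd f = 1 := by simp [colProd]

lemma colProd_castSucc (f : Fin (k + 1) → Matrix S S ℂ) :
    colProd f = f (Fin.last k) * colProd fun j => f j.castSucc := by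
  rw [colProd, List.ofFn_succ', List.concat_eq_append]
  simp [colProd]

lemma colProd_succ (f : Fin (k + 1) → Matrix S S ℂ) :
    colProd f = (colProd fun j => f j.succ) * f 0 := by
  simp [colProd, List.ofFn_succ]

/-- The train argument: an intertwiner of the single columns intertwines their products. -/
lemma mul_colProd_eq (R : Matrix S S ℂ) (A B : Fin k → Matrix S S ℂ)
    (h : ∀ j, R * A j = B j * R) : R * colProd A = colProd B * R := by
  induction k with
  | zero => simp [colProd_zero]
  | succ k ih =>
    rw [colProd_castSucc, colProd_castSucc, ← mul_assoc, h, mul_assoc, ih _ _ fun j => h _,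
      mul_assoc]

end colProd

/-- Number of `+` spins at positions up to `i`. -/
def plusCount {m : ℕ} (e : Fin m → Spin) (i : Fin m) : ℕ :=
  (Finset.univ.filter fun k : Fin m => k ≤ i ∧ e k = plus).card

/-- Number of `-` spins at positions from `i` on. -/
def minusCount {m : ℕ} (e : Fin m → Spin) (i : Fin m) : ℕ :=
  (Finset.univ.filter fun k : Fin m => i ≤ k ∧ e k = minus).card

lemma plusCount_snoc_castSucc {m : ℕ} (e : Fin m → Spin) (s : Spin) (i : Fin m) :
    plusCount (Fin.snoc e s : Fin (m + 1) → Spin) i.castSucc = plusCount e i := by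
  simp only [plusCount, Finset.card_filter, Fin.sum_univ_castSucc, Fin.snoc_castSucc,
    Fin.castSucc_le_castSucc_iff]
  simp [Fin.last_le_iff, Fin.castSucc_ne_last]

lemma plusCount_snoc_last {m : ℕ} (e : Fin (m + 1) → Spin) (s : Spin) :
    plusCount (Fin.snoc e s : Fin (m + 2) → Spin) (Fin.last (m + 1)) =
      plusCount e (Fin.last m) + if s = plus then 1 else 0 := by
  simp only [plusCount, Finset.card_filter, Fin.le_last, true_and]
  rw [Fin.sum_univ_castSucc]
  simp

lemma minusCount_cons_succ {m : ℕ} (e : Fin m → Spin) (s : Spin) (i : Fin m) :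
    minusCount (Fin.cons s e : Fin (m + 1) → Spin) i.succ = minusCount e i := by
  simp only [minusCount, Finset.card_filter]
  rw [Fin.sum_univ_succ]
  simp

lemma minusCount_cons_zero {m : ℕ} (e : Fin (m + 1) → Spin) (s : Spin) :
    minusCount (Fin.cons s e : Fin (m + 2) → Spin) 0 =
      minusCount e 0 + if s = minus then 1 else 0 := by
  simp only [minusCount, Finset.card_filter, Fin.zero_le, true_and]
  rw [Fin.sum_univ_succ]
  simp [add_comm]

/-- Product of the Gamma weights of a row of `k` columns. The number of columns may be zero, which
serves as the start of inductions on `k`. -/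
def gammaRow (g h : ℕ → ℂ) (z : ℂ) {k : ℕ} (α β : Fin k → Spin) (e : Fin (k + 1) → Spin) : ℂ :=
  ∏ j : Fin k, gammaWeight g h z (plusCount e j.castSucc) (e j.succ) (α j) (e j.castSucc) (β j)

/-- Product of the Delta weights of a row of `k` columns. -/
def deltaRow (g h : ℕ → ℂ) (z : ℂ) {k : ℕ} (α β : Fin k → Spin) (e : Fin (k + 1) → Spin) : ℂ :=
  ∏ j : Fin k, deltaWeight g h z (minusCount e j.succ) (e j.succ) (α j) (e j.castSucc) (β j)

variable {n : ℕ}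

/-- Partition function of a Gamma row with right spin `-`, left spin `s`, and `c` mod `n` spins
`+` in total. -/
def gammaSum (g h : ℕ → ℂ) (z : ℂ) {k : ℕ} (α β : Fin k → Spin) (s : Spin) (c : ZMod n) : ℂ :=
  ∑ e : Fin (k + 1) → Spin,
    if e 0 = minus ∧ e (Fin.last k) = s ∧ (plusCount e (Fin.last k) : ZMod n) = c
    then gammaRow g h z α β e else 0

/-- Partition function of a Delta row with left spin `+`, right spin `s`, and `c` mod `n` spins
`-` in total. -/
def deltaSum (g h : ℕ → ℂ) (z : ℂ) {k : ℕ} (α β : Fin k → Spin) (s : Spin) (c : ZMod n) : ℂ :=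
  ∑ e : Fin (k + 1) → Spin,
    if e (Fin.last k) = plus ∧ e 0 = s ∧ (minusCount e 0 : ZMod n) = c
    then deltaRow g h z α β e else 0

section recursion
variable (g h : ℕ → ℂ) (z : ℂ) (gz hz : ZMod n → ℂ)

/-- The Gamma weight as a function of the charge modulo `n`. -/
def gammaWeightMod (z : ℂ) (c : ZMod n) (w x y s : Spin) : ℂ :=
  gammaWeight (fun _ => gz c) (fun _ => hz c) z 0 w x y s

/-- The Delta weight as a function of the charge modulo `n`. -/
def deltaWeightMod (z : ℂ) (c : ZMod n) (w x y s : Spin) : ℂ :=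
  deltaWeight (fun _ => gz c) (fun _ => hz c) z 0 w x y s

variable (hgz : ∀ a, g a = gz a) (hhz : ∀ a, h a = hz a)
include hgz hhz

lemma gammaWeight_eq (a : ℕ) (w x y s : Spin) :
    gammaWeight g h z a w x y s = gammaWeightMod gz hz z a w x y s := by
  cases w <;> cases x <;> cases y <;> cases s <;> simp [gammaWeight, gammaWeightMod, hgz, hhz]

lemma deltaWeight_eq (a : ℕ) (w x y s : Spin) :
    deltaWeight g h z a w x y s = deltaWeightMod gz hz z a w x y s := by
  cases w <;> cases x <;> cases y <;> cases s <;> simp [deltaWeight, deltaWeightMod, hgz, hhz]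

omit hgz hhz in
lemma gammaRow_snoc {k : ℕ} (α β : Fin (k + 1) → Spin) (e : Fin (k + 1) → Spin) (s : Spin) :
    gammaRow g h z α β (Fin.snoc e s : Fin (k + 2) → Spin) =
      gammaWeight g h z (plusCount e (Fin.last k)) s (α (Fin.last k)) (e (Fin.last k))
        (β (Fin.last k)) *
      gammaRow g h z (fun j => α j.castSucc) (fun j => β j.castSucc) e := by
  simp only [gammaRow, Fin.prod_univ_castSucc, plusCount_snoc_castSucc, Fin.snoc_castSucc,
    Fin.succ_last, Fin.snoc_last, Fin.succ_castSucc]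
  rw [mul_comm]

omit hgz hhz in
lemma deltaRow_cons {k : ℕ} (α β : Fin (k + 1) → Spin) (e : Fin (k + 1) → Spin) (s : Spin) :
    deltaRow g h z α β (Fin.cons s e : Fin (k + 2) → Spin) =
      deltaWeight g h z (minusCount e 0) (e 0) (α 0) s (β 0) *
      deltaRow g h z (fun j => α j.succ) (fun j => β j.succ) e := by
  simp only [deltaRow, Fin.prod_univ_succ, minusCount_cons_succ, Fin.cons_succ,
    Fin.castSucc_zero, Fin.cons_zero, Fin.castSucc_succ]

/-- Removing the leftmost column, the last one to enter a charge counted from the right. -/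
lemma gammaSum_succ {k : ℕ} (α β : Fin (k + 1) → Spin) (s : Spin) (c : ZMod n) :
    gammaSum g h z α β s c =
      ∑ t, gammaWeightMod gz hz z (c - if s = plus then 1 else 0) s (α (Fin.last k)) t
          (β (Fin.last k)) *
        gammaSum g h z (fun j => α j.castSucc) (fun j => β j.castSucc) t
          (c - if s = plus then 1 else 0) := by
  simp only [gammaSum, Finset.mul_sum]
  rw [Finset.sum_comm, ← (Fin.snocEquiv fun _ => Spin).sum_comp, Fintype.sum_prod_type_right]
  refine Finset.sum_congr rfl fun e _ => ?_
  rw [Finset.sum_eq_single s, Finset.sum_eq_single (e (Fin.last k))]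
  · have hs : (Fin.snocEquiv fun _ => Spin) (s, e) = (Fin.snoc e s : Fin (k + 2) → Spin) := rfl
    rw [hs, gammaRow_snoc, gammaWeight_eq g h z gz hz hgz hhz, plusCount_snoc_last]
    simp only [← Fin.castSucc_zero, Fin.snoc_castSucc, Fin.snoc_last, eq_sub_iff_add_eq, true_and,
      Nat.cast_add, Nat.cast_ite, Nat.cast_one, Nat.cast_zero, mul_ite, mul_zero]
    split_ifs <;> simp_all [← eq_sub_iff_add_eq]
  · intro t _ ht
    simp [ht.symm]
  · simp
  · intro t _ ht
    simp [Fin.snocEquiv, ht]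
  · simp

/-- Removing the rightmost column, the last one to enter a charge counted from the left. -/
lemma deltaSum_succ {k : ℕ} (α β : Fin (k + 1) → Spin) (s : Spin) (c : ZMod n) :
    deltaSum g h z α β s c =
      ∑ t, deltaWeightMod gz hz z (c - if s = minus then 1 else 0) t (α 0) s (β 0) *
        deltaSum g h z (fun j => α j.succ) (fun j => β j.succ) t
          (c - if s = minus then 1 else 0) := by
  simp only [deltaSum, Finset.mul_sum]
  rw [Finset.sum_comm, ← (Fin.consEquiv fun _ => Spin).sum_comp, Fintype.sum_prod_type_right]
  refine Finset.sum_congr rfl fun e _ => ?_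
  rw [Finset.sum_eq_single s, Finset.sum_eq_single (e 0)]
  · have hs : (Fin.consEquiv fun _ => Spin) (s, e) = (Fin.cons s e : Fin (k + 2) → Spin) := rfl
    rw [hs, deltaRow_cons, deltaWeight_eq g h z gz hz hgz hhz, minusCount_cons_zero]
    simp only [← Fin.succ_last, Fin.cons_succ, Fin.cons_zero, eq_sub_iff_add_eq, true_and,
      Nat.cast_add, Nat.cast_ite, Nat.cast_one, Nat.cast_zero, mul_ite, mul_zero]
    split_ifs <;> simp_all [← eq_sub_iff_add_eq]
  · intro t _ ht
    simp [ht.symm]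
  · simp
  · intro t _ ht
    simp [Fin.consEquiv, ht]
  · simp

end recursion

section decorated
variable [NeZero n] (g h : ℕ → ℂ) (v z : ℂ) (gz : ZMod n → ℂ)
  (hgz : ∀ a, g a = gz a) (hh : ∀ a : ℕ, h a = if (a : ZMod n) = 0 then 1 - v else 0)
include hgz hh

omit [NeZero n] in
/-- A Gamma row whose left spin is `-` has weight zero unless its charge is `0` mod `n`: read from
right to left, the last passage from `+` to `-` contributes a factor `h(c)`. -/
lemma gammaSum_minus {k : ℕ} (α β : Fin k → Spin) {c : ZMod n} (hc : c ≠ 0) :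
    gammaSum g h z α β minus c = 0 := by
  induction k with
  | zero =>
    refine Finset.sum_eq_zero fun e _ => if_neg ?_
    rintro ⟨h₁, -, h₂⟩
    simp [plusCount, Finset.filter_eq_empty_iff.2, h₁] at h₂
    exact hc h₂.symm
  | succ k ih =>
    rw [gammaSum_succ g h z gz (fun c => if c = 0 then 1 - v else 0) hgz hh, sum_spin]
    simp only [reduceCtorEq, if_false, sub_zero, ih, mul_zero, add_zero]
    cases α (Fin.last k) <;> cases β (Fin.last k) <;> simp [gammaWeightMod, gammaWeight, hc]

omit [NeZero n] in
/-- A Delta row whose right spin is `+` has weight zero unless its charge is `0` mod `n`. -/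
lemma deltaSum_plus {k : ℕ} (α β : Fin k → Spin) {c : ZMod n} (hc : c ≠ 0) :
    deltaSum g h z α β plus c = 0 := by
  induction k with
  | zero =>
    refine Finset.sum_eq_zero fun e _ => if_neg ?_
    rintro ⟨h₁, -, h₂⟩
    rw [Fin.last_zero] at h₁
    simp [minusCount, Finset.filter_eq_empty_iff.2, h₁] at h₂
    exact hc h₂.symm
  | succ k ih =>
    rw [deltaSum_succ g h z gz (fun c => if c = 0 then 1 - v else 0) hgz hh, sum_spin]
    simp only [reduceCtorEq, if_false, sub_zero, ih, mul_zero, zero_add]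
    cases α 0 <;> cases β 0 <;> simp [deltaWeightMod, deltaWeight, hc]

theorem gammaSum_eq_colProd {k : ℕ} (α β : Fin k → Spin) :
    (gammaSum g h z α β minus (0 : ZMod n) =
      colProd (fun j => gammaVertex gz v z (α j) (β j)) none none) ∧
    ∀ a : ZMod n, gammaSum g h z α β plus a =
      colProd (fun j => gammaVertex gz v z (α j) (β j)) (some a) none := by
  induction k with
  | zero =>
    rw [colProd_zero]
    simp only [gammaSum, gammaRow, ← (Equiv.funUnique (Fin 1) Spin).symm.sum_comp, sum_spin]
    simp [plusCount]
  | succ k ih =>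
    obtain ⟨ih₁, ih₂⟩ := ih (fun j => α j.castSucc) fun j => β j.castSucc
    have ih₃ := fun c => gammaSum_minus g h v z gz hgz hh (fun j => α j.castSucc)
      (fun j => β j.castSucc) (c := c)
    simp only [gammaSum_succ g h z gz (fun c => if c = 0 then 1 - v else 0) hgz hh, sum_spin,
      colProd_castSucc, Matrix.mul_apply, Fintype.sum_option, ← ih₁, ← ih₂]
    constructor
    · cases α (Fin.last k) <;> cases β (Fin.last k) <;>
        simp [gammaWeightMod, gammaWeight, gammaVertex]
    · intro a
      cases α (Fin.last k) <;> cases β (Fin.last k) <;>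
        simp [gammaWeightMod, gammaWeight, gammaVertex, ← sub_eq_iff_eq_add]
      split_ifs with ha
      · simp [ha]
      · exact ih₃ _ (sub_ne_zero.2 ha)

theorem deltaSum_eq_colProd {k : ℕ} (α β : Fin k → Spin) :
    (deltaSum g h z α β plus (0 : ZMod n) =
      colProd (fun j => deltaVertex gz v z (α j) (β j)) none none) ∧
    ∀ b : ZMod n, deltaSum g h z α β minus b =
      colProd (fun j => deltaVertex gz v z (α j) (β j)) none (some b) := by
  induction k with
  | zero =>
    rw [colProd_zero]
    simp only [deltaSum, deltaRow, ← (Equiv.funUnique (Fin 1) Spin).symm.sum_comp, sum_spin]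
    simp [minusCount]
  | succ k ih =>
    obtain ⟨ih₁, ih₂⟩ := ih (fun j => α j.succ) fun j => β j.succ
    have ih₃ := fun c => deltaSum_plus g h v z gz hgz hh (fun j => α j.succ)
      (fun j => β j.succ) (c := c)
    simp only [deltaSum_succ g h z gz (fun c => if c = 0 then 1 - v else 0) hgz hh, sum_spin,
      colProd_succ, Matrix.mul_apply, Fintype.sum_option, ← ih₁, ← ih₂]
    constructor
    · cases α 0 <;> cases β 0 <;>
        simp [deltaWeightMod, deltaWeight, deltaVertex, mul_comm]
    · intro a
      cases α 0 <;> cases β 0 <;>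
        simp [deltaWeightMod, deltaWeight, deltaVertex, ← eq_sub_iff_add_eq, mul_comm]
      split_ifs with ha
      · simp [ha]
      · exact ih₃ _ (sub_ne_zero.2 ha)

omit [NeZero n] hgz hh in
lemma gammaWeight_eq_zero {a : ℕ} {w x y s : Spin} (hv : (w, x, y, s) ∉ admissibleVertices) :
    gammaWeight g h z a w x y s = 0 := by
  revert hv
  cases w <;> cases x <;> cases y <;> cases s <;> simp [gammaWeight, admissibleVertices]

omit [NeZero n] hgz hh in
lemma deltaWeight_eq_zero {a : ℕ} {w x y s : Spin} (hv : (w, x, y, s) ∉ admissibleVertices) :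
    deltaWeight g h z a w x y s = 0 := by
  revert hv
  cases w <;> cases x <;> cases y <;> cases s <;> simp [deltaWeight, admissibleVertices]

omit [NeZero n] hgz hh in
/-- If inadmissible vertices have weight zero, admissibility need not be imposed on the row. -/
lemma transferMatrix_eq_sum {N : ℕ} (B : RowBoltzmann N)
    (hB : ∀ α e β j, (e j.succ, α j, e j.castSucc, β j) ∉ admissibleVertices → B α e β j = 0)
    (α β : ColSpins N) :
    transferMatrix B α β =
      ∑ e : RowSpins N, if e (Fin.last (N + 1)) = plus ∧ e 0 = minus then ∏ j, B α e β j
        else 0 := by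
  rw [transferMatrix, Finset.sum_filter]
  refine Finset.sum_congr rfl fun e _ => ?_
  by_cases hb : e (Fin.last (N + 1)) = plus ∧ e 0 = minus
  · by_cases ha : ∀ j : Fin (N + 1), (e j.succ, α j, e j.castSucc, β j) ∈ admissibleVertices
    · rw [if_pos hb, if_pos ⟨hb.1, hb.2, ha⟩]
    · rw [if_pos hb, if_neg fun h => ha h.2.2]
      push Not at ha
      obtain ⟨j, hj⟩ := ha
      exact (Finset.prod_eq_zero (Finset.mem_univ j) (hB _ _ _ _ hj)).symm
  · rw [if_neg hb, if_neg fun h => hb ⟨h.1, h.2.1⟩]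

theorem transferMatrix_gammaIce {N : ℕ} (α β : ColSpins N) :
    transferMatrix (gammaIce g h z) α β =
      ∑ a : ZMod n, colProd (fun j => gammaVertex gz v z (α j) (β j)) (some a) none := by
  rw [transferMatrix_eq_sum (gammaIce g h z) fun _ _ _ _ => gammaWeight_eq_zero g h z]
  simp only [← (gammaSum_eq_colProd g h v z gz hgz hh α β).2, gammaSum]
  rw [Finset.sum_comm]
  refine Finset.sum_congr rfl fun e _ => ?_
  by_cases h₁ : e 0 = minus <;> by_cases h₂ : e (Fin.last (N + 1)) = plus <;> simp [h₁, h₂]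
  rfl

theorem transferMatrix_deltaIce {N : ℕ} (α β : ColSpins N) :
    transferMatrix (deltaIce g h z) α β =
      ∑ b : ZMod n, colProd (fun j => deltaVertex gz v z (α j) (β j)) none (some b) := by
  rw [transferMatrix_eq_sum (deltaIce g h z) fun _ _ _ _ => deltaWeight_eq_zero g h z]
  simp only [← (deltaSum_eq_colProd g h v z gz hgz hh α β).2, deltaSum]
  rw [Finset.sum_comm]
  refine Finset.sum_congr rfl fun e _ => ?_
  by_cases h₁ : e 0 = minus <;> by_cases h₂ : e (Fin.last (N + 1)) = plus <;> simp [h₁, h₂]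
  rfl

end decorated

/-- Gluing two rows along the vertical edges between them, column by column. -/
lemma sum_colProd_kronecker {S T : Type*} [Fintype S] [DecidableEq S] [Fintype T] [DecidableEq T]
    {k : ℕ} (A : Fin k → Spin → Matrix S S ℂ) (B : Fin k → Spin → Matrix T T ℂ) :
    ∑ β : Fin k → Spin, colProd (fun j => A j (β j)) ⊗ₖ colProd (fun j => B j (β j)) =
      colProd fun j => ∑ s, A j s ⊗ₖ B j s := by
  induction k with
  | zero => simp [colProd_zero]
  | succ k ih =>
    rw [← (Fin.snocEquiv fun _ => Spin).sum_comp, Fintype.sum_prod_type]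
    simp only [colProd_castSucc, Fin.snocEquiv_apply, Fin.snoc_castSucc, Fin.snoc_last,
      Matrix.mul_kronecker_mul, ← ih, Finset.sum_mul_sum]

lemma twoLayerZ_eq_mul {N : ℕ} (B₁ B₂ : RowBoltzmann N) (α γ : ColSpins N) :
    twoLayerZ B₁ B₂ α γ = (transferMatrix B₁ * transferMatrix B₂) α γ := by
  simp only [twoLayerZ, Matrix.mul_apply, transferMatrix, Finset.sum_filter, Finset.sum_mul_sum,
    Fintype.sum_prod_type]
  rw [Finset.sum_comm]
  refine Finset.sum_congr rfl fun β _ => Finset.sum_congr rfl fun e _ =>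
    Finset.sum_congr rfl fun f _ => ?_
  by_cases h₁ : IsRowState α e β <;> by_cases h₂ : IsRowState β f γ <;> simp [h₁, h₂]

/-! ### The train argument -/

section commute
variable [NeZero n] (g h : ℕ → ℂ) (v z₁ z₂ : ℂ) (gz : ZMod n → ℂ)
  (hgz : ∀ a, g a = gz a) (hh : ∀ a : ℕ, h a = if (a : ZMod n) = 0 then 1 - v else 0)
include hgz hh

theorem gammaIce_mul_deltaIce_apply {N : ℕ} (α γ : ColSpins N) :
    twoLayerZ (gammaIce g h z₁) (deltaIce g h z₂) α γ =
      ∑ a : ZMod n, ∑ b : ZMod n, colProd (fun j => gammaDeltaColumn gz v z₁ z₂ (α j) (γ j))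
        (some a, none) (none, some b) := by
  rw [twoLayerZ_eq_mul]
  simp only [gammaDeltaColumn, ← sum_colProd_kronecker fun j s => gammaVertex gz v z₁ (α j) s,
    Matrix.mul_apply, transferMatrix_gammaIce g h v z₁ gz hgz hh,
    transferMatrix_deltaIce g h v z₂ gz hgz hh, Finset.sum_mul_sum, Matrix.sum_apply,
    Matrix.kronecker_apply]
  rw [Finset.sum_comm]
  exact Finset.sum_congr rfl fun a _ => Finset.sum_comm

theorem deltaIce_mul_gammaIce_apply {N : ℕ} (α γ : ColSpins N) :
    twoLayerZ (deltaIce g h z₂) (gammaIce g h z₁) α γ =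
      ∑ a : ZMod n, ∑ b : ZMod n, colProd (fun j => deltaGammaColumn gz v z₁ z₂ (α j) (γ j))
        (some a, none) (none, some b) := by
  rw [twoLayerZ_eq_mul]
  simp only [deltaGammaColumn,
    ← sum_colProd_kronecker (fun j s => gammaVertex gz v z₁ s (γ j)),
    Matrix.mul_apply, transferMatrix_gammaIce g h v z₁ gz hgz hh,
    transferMatrix_deltaIce g h v z₂ gz hgz hh, Finset.sum_mul_sum, Matrix.sum_apply,
    Matrix.kronecker_apply]
  rw [Finset.sum_comm]
  conv_rhs => rw [Finset.sum_comm]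
  refine Finset.sum_congr rfl fun b _ => ?_
  rw [Finset.sum_comm]
  exact Finset.sum_congr rfl fun a _ => Finset.sum_congr rfl fun β _ => mul_comm _ _

theorem boundaryScalar_mul_commute {N : ℕ} (hg0 : gz 0 = -v) (hg : ∀ a, a ≠ 0 → gz a * gz (-a) = v)
    (α γ : ColSpins N) :
    boundaryScalar n v z₁ z₂ * twoLayerZ (gammaIce g h z₁) (deltaIce g h z₂) α γ =
    boundaryScalar n v z₁ z₂ * twoLayerZ (deltaIce g h z₂) (gammaIce g h z₁) α γ := by
  rw [gammaIce_mul_deltaIce_apply g h v z₁ z₂ gz hgz hh,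
    deltaIce_mul_gammaIce_apply g h v z₁ z₂ gz hgz hh]
  simp only [Finset.mul_sum]
  refine Finset.sum_congr rfl fun a _ => Finset.sum_congr rfl fun b _ => ?_
  have key := congrFun (congrFun (mul_colProd_eq (rMatrix gz v z₁ z₂) _ _ fun j =>
    yangBaxter gz v z₁ z₂ hg0 hg (α j) (γ j)) (some a, none)) (none, some b)
  -- The R-matrix is diagonal on the left boundary states `(+, +)` and the right ones `(-, -)`.
  rw [Matrix.mul_apply, Matrix.mul_apply, Finset.sum_eq_single (some a, none),
    Finset.sum_eq_single (none, some b)] at key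
  · simpa [rMatrix, mul_comm] using key
  · rintro ⟨_ | x, _ | y⟩ - hx <;> simp_all [rMatrix]
  · simp
  · rintro ⟨_ | x, _ | y⟩ - hx <;> simp_all [rMatrix]
    exact fun h => absurd h.symm hx
  · simp

theorem twoLayerZ_gammaIce_deltaIce_comm {N : ℕ} (hg0 : gz 0 = -v)
    (hg : ∀ a, a ≠ 0 → gz a * gz (-a) = v) (α γ : ColSpins N) :
    twoLayerZ (gammaIce g h z₁) (deltaIce g h z₂) α γ =
      twoLayerZ (deltaIce g h z₂) (gammaIce g h z₁) α γ := by
  have hc : ∀ (a : ℕ) (w x y s : Spin), Continuous fun z => gammaWeight g h z a w x y s := by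
    intro a w x y s
    cases w <;> cases x <;> cases y <;> cases s <;> simp only [gammaWeight] <;> fun_prop
  have hfin : Set.Finite {z | boundaryScalar n v z z₂ = 0} := by
    refine (Polynomial.nthRoots n (v * z₂ ^ n)).toFinset.finite_toSet.subset fun z hz => ?_
    simpa [Polynomial.mem_nthRoots (NeZero.pos n), boundaryScalar, sub_eq_zero, eq_comm] using hz
  have hd : Dense {z | boundaryScalar n v z z₂ = 0}ᶜ := hfin.countable.dense_compl ℂ
  refine congrFun (Continuous.ext_on hd ?_ ?_ fun z hz => mul_left_cancel₀ hz
    (boundaryScalar_mul_commute g h v z z₂ gz hgz hh hg0 hg α γ)) z₁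
  · unfold twoLayerZ gammaIce
    fun_prop
  · unfold twoLayerZ gammaIce
    fun_prop

end commute

end rows

/-! ### Integration over the units of the ring of integers -/

section residue
variable {F : Type*} [Field F] [ValuativeRel F] [TopologicalSpace F]
  [IsNonarchimedeanLocalField F]

lemma residue_eq_zero_iff_valuation_lt_one (x : 𝒪[F]) :
    residue 𝒪[F] x = 0 ↔ valuation F (x : F) < 1 := by
  rw [residue_eq_zero_iff, mem_maximalIdeal, mem_nonunits_iff,
    Valuation.Integer.not_isUnit_iff_valuation_lt_one]

lemma residue_eq_iff_valuation_sub_lt_one (x y : 𝒪[F]) :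
    residue 𝒪[F] x = residue 𝒪[F] y ↔ valuation F (x - y : F) < 1 := by
  rw [← sub_eq_zero, ← map_sub, residue_eq_zero_iff_valuation_lt_one]
  rfl

lemma residue_ne_zero_iff_valuation_eq_one (x : 𝒪[F]) :
    residue 𝒪[F] x ≠ 0 ↔ valuation F (x : F) = 1 := by
  rw [Ne, residue_eq_zero_iff_valuation_lt_one, not_lt]
  exact ⟨fun h => le_antisymm x.2 h, fun h => h.ge⟩

/-- The elements of `F` that are integral with residue `x`. -/
def residueClass (x : 𝓀[F]) : Set F := {u | ∃ y : 𝒪[F], (y : F) = u ∧ residue 𝒪[F] y = x}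

lemma residueClass_residue (y : 𝒪[F]) :
    residueClass (residue 𝒪[F] y) = (fun u => -(y : F) + u) ⁻¹' {u | valuation F u < 1} := by
  ext u
  simp only [residueClass, Set.mem_ofPred_eq, Set.mem_preimage]
  constructor
  · rintro ⟨w, rfl, h⟩
    rw [residue_eq_iff_valuation_sub_lt_one] at h
    rwa [neg_add_eq_sub]
  · intro h
    have hu : valuation F u ≤ 1 := by
      have := Valuation.map_add (valuation F) (y : F) (-(y : F) + u)
      rw [add_neg_cancel_left] at this
      exact this.trans (max_le y.2 h.le)
    exact ⟨⟨u, hu⟩, rfl, (residue_eq_iff_valuation_sub_lt_one _ _).2 (by rwa [← neg_add_eq_sub])⟩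

lemma isOpen_residueClass (x : 𝓀[F]) : IsOpen (residueClass x) := by
  obtain ⟨y, rfl⟩ := residue_surjective x
  rw [residueClass_residue]
  have h : IsOpen {u : F | valuation F u < 1} := by
    simpa [Valuation.restrict_lt_one_iff] using
      Valuation.isOpen_ball (v := valuation F) 1
  exact h.preimage (by fun_prop)

lemma pairwise_disjoint_residueClass :
    Pairwise (Function.onFun Disjoint (residueClass : 𝓀[F] → Set F)) := by
  intro x y hxy
  rw [Function.onFun, Set.disjoint_left]
  rintro u ⟨a, rfl, rfl⟩ ⟨b, hb, rfl⟩
  exact hxy (by rw [Subtype.ext hb])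

noncomputable instance : Fintype 𝓀[F] := Fintype.ofFinite _

variable [MeasurableSpace F] [BorelSpace F]

instance : (haar F).IsAddHaarMeasure := by unfold haar; infer_instance

lemma haar_residueClass (x : 𝓀[F]) : (haar F).real (residueClass x) = (Nat.card 𝓀[F] : ℝ)⁻¹ := by
  have h₁ : ∀ x : 𝓀[F], (haar F) (residueClass x) = haar F {u | valuation F u < 1} := by
    intro x
    obtain ⟨y, rfl⟩ := residue_surjective x
    rw [residueClass_residue, measure_preimage_add]
  have h₂ : haar F {u | valuation F u ≤ 1} = 1 :=
    Measure.addHaarMeasure_self (K₀ := integersPositiveCompacts F)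
  have h₃ : {u | valuation F u ≤ 1} = ⋃ x ∈ (Finset.univ : Finset 𝓀[F]), residueClass x := by
    ext u
    simp only [Set.mem_ofPred_eq, Finset.mem_univ, Set.iUnion_true, Set.mem_iUnion]
    exact ⟨fun hu => ⟨residue 𝒪[F] ⟨u, hu⟩, ⟨u, hu⟩, rfl, rfl⟩, by rintro ⟨_, y, rfl, -⟩; exact y.2⟩
  rw [h₃, measure_biUnion_finset (fun x _ y _ hxy => pairwise_disjoint_residueClass hxy)
    fun x _ => (isOpen_residueClass x).measurableSet] at h₂
  simp only [h₁, Finset.sum_const, Finset.card_univ, nsmul_eq_mul] at h₂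
  rw [mul_comm] at h₂
  rw [measureReal_def, h₁, ENNReal.eq_inv_of_mul_eq_one_left h₂]
  simp [Nat.card_eq_fintype_card]

/-- The integral over the units of a function of the residue is the sum of its values, each residue
class having measure `1 / q`. -/
lemma setIntegral_units (f : F → ℂ) (Φ : 𝓀[F] → ℂ)
    (hf : ∀ y : 𝒪[F], valuation F (y : F) = 1 → f y = Φ (residue 𝒪[F] y)) (h0 : Φ 0 = 0) :
    ∫ u in {u : F | valuation F u = 1}, f u ∂(haar F) = (Nat.card 𝓀[F] : ℂ)⁻¹ * ∑ x, Φ x := by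
  classical
  have hU : {u : F | valuation F u = 1} =
      ⋃ x ∈ (Finset.univ.erase (0 : 𝓀[F])), residueClass x := by
    ext u
    simp only [Set.mem_ofPred_eq, Finset.mem_erase, Finset.mem_univ, and_true, Set.mem_iUnion,
      exists_prop]
    constructor
    · intro hu
      exact ⟨residue 𝒪[F] ⟨u, hu.le⟩, (residue_ne_zero_iff_valuation_eq_one _).2 hu, _, rfl, rfl⟩
    · rintro ⟨_, hx, y, rfl, rfl⟩
      exact (residue_ne_zero_iff_valuation_eq_one _).1 hx
  have hc : ∀ x ∈ Finset.univ.erase (0 : 𝓀[F]), Set.EqOn f (fun _ => Φ x) (residueClass x) := by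
    rintro x hx u ⟨y, rfl, rfl⟩
    exact hf y ((residue_ne_zero_iff_valuation_eq_one _).1 (Finset.ne_of_mem_erase hx))
  have hm : ∀ x : 𝓀[F], haar F (residueClass x) ≠ ⊤ := fun x h => by
    have := haar_residueClass x
    rw [measureReal_def, h, ENNReal.toReal_top] at this
    exact inv_ne_zero (Nat.cast_ne_zero.2 Nat.card_pos.ne') this.symm
  rw [hU, integral_biUnion_finset _ (fun x _ => (isOpen_residueClass x).measurableSet)
    (fun x _ y _ hxy => pairwise_disjoint_residueClass hxy)
    fun x hx => (integrableOn_const (hm x)).congr_fun (hc x hx).symm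
      (isOpen_residueClass x).measurableSet, ← Finset.add_sum_erase _ _ (Finset.mem_univ 0), h0,
    zero_add, Finset.mul_sum]
  refine Finset.sum_congr rfl fun x hx => ?_
  rw [setIntegral_congr_fun (isOpen_residueClass x).measurableSet (hc x hx), setIntegral_const,
    haar_residueClass]
  simp

end residue

/-! ### The Hilbert symbol and the power residue character -/

section hilbert
variable {F : Type*} [Field F] [ValuativeRel F] [TopologicalSpace F]
  [IsNonarchimedeanLocalField F]

lemma ord_of_valuation_eq_one {u : F} (hu : valuation F u = 1) : ord F u = 0 := by
  simp [ord, hu]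

lemma ord_uniformizer {p : 𝒪[F]} (hp : Irreducible p) : ord F (p : F) = 1 := by
  set e := IsNonarchimedeanLocalField.valueGroupWithZeroIsoInt F
  obtain ⟨x, hx⟩ := valuation_surjective (e.symm (WithZero.exp (-1 : ℤ)))
  have hx1 : valuation F x < 1 := by
    rw [hx, ← map_one e.symm, e.symm.strictMono.lt_iff_lt, ← WithZero.exp_zero, WithZero.exp_lt_exp]
    norm_num
  have hdvd : p ∣ ⟨x, hx1.le⟩ := by
    rw [← Ideal.mem_span_singleton, ← (IsDiscreteValuationRing.irreducible_iff_uniformizer p).1 hp,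
      mem_maximalIdeal, mem_nonunits_iff, Valuation.Integer.not_isUnit_iff_valuation_lt_one]
    exact hx1
  have h₁ : WithZero.exp (-1 : ℤ) ≤ e (valuation F p) := by
    have := (Valuation.integer.integers (valuation F)).le_of_dvd hdvd
    change valuation F x ≤ valuation F p at this
    rw [hx] at this
    simpa using e.strictMono.monotone this
  have h₂ : e (valuation F p) < WithZero.exp 0 := by
    rw [WithZero.exp_zero, ← map_one e, e.strictMono.lt_iff_lt]
    exact Valuation.integer.v_irreducible_lt_one hp
  have h₃ : e (valuation F p) ≠ 0 := (lt_of_lt_of_le (by simp) h₁).ne'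
  rw [← WithZero.exp_log h₃, WithZero.exp_le_exp] at h₁
  rw [← WithZero.exp_log h₃, WithZero.exp_lt_exp] at h₂
  change -WithZero.log (e (valuation F p)) = 1
  omega

lemma tameUnit_uniformizer {u : F} (hu : valuation F u = 1) {p : 𝒪[F]} (hp : Irreducible p) :
    tameUnit u (p : F) = u := by
  simp [tameUnit, ord_of_valuation_eq_one hu, ord_uniformizer hp]

variable (F) in
lemma natCast_residueField_ne_zero {n : ℕ} (hn : n ∣ Nat.card 𝓀[F] - 1) : (n : 𝓀[F]) ≠ 0 := by
  obtain ⟨m, hm⟩ := hn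
  have hq : 1 ≤ Nat.card 𝓀[F] := Nat.card_pos
  have h := FiniteField.cast_card_eq_zero 𝓀[F]
  rw [← Nat.card_eq_fintype_card, ← Nat.sub_add_cancel hq, hm] at h
  intro h0
  simp [h0] at h

omit [TopologicalSpace F] [IsNonarchimedeanLocalField F] in
variable (F) in
lemma bijective_restrictRootsOfUnity_algebraMap (n : ℕ) [NeZero n] :
    Function.Bijective (restrictRootsOfUnity (algebraMap 𝒪[F] F) n) := by
  constructor
  · intro a b h
    ext
    exact congrArg (fun z : rootsOfUnity n F => ((z : Fˣ) : F)) h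
  · intro ζ
    have hζ : ((ζ : Fˣ) : F) ^ n = 1 := (mem_rootsOfUnity' n _).1 ζ.2
    have hv : valuation F ((ζ : Fˣ) : F) ≤ 1 := by
      by_contra! h
      have := one_lt_pow₀ h (NeZero.ne n)
      rw [← map_pow, hζ, map_one] at this
      exact lt_irrefl _ this
    refine ⟨rootsOfUnity.mkOfPowEq (⟨(ζ : Fˣ), hv⟩ : 𝒪[F]) (Subtype.ext hζ), ?_⟩
    ext
    rfl

/-- If `ζ ^ n = 1` and `ζ` reduces to `1`, then `1 + ζ + ⋯ + ζ ^ (n - 1)` reduces to `n`, which is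
not zero in the residue field; hence `ζ = 1`. -/
lemma injective_restrictRootsOfUnity_residue {n : ℕ} (hn : n ∣ Nat.card 𝓀[F] - 1) :
    Function.Injective (restrictRootsOfUnity (residue 𝒪[F]) n) := by
  refine (injective_iff_map_eq_one _).2 fun ζ hζ => ?_
  have h₁ : residue 𝒪[F] ((ζ : 𝒪[F]ˣ) : 𝒪[F]) = 1 :=
    congrArg (fun z : rootsOfUnity n 𝓀[F] => ((z : 𝓀[F]ˣ) : 𝓀[F])) hζ
  have h₂ : ((ζ : 𝒪[F]ˣ) : 𝒪[F]) ^ n = 1 := (mem_rootsOfUnity' n _).1 ζ.2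
  have h₃ := mul_geom_sum ((ζ : 𝒪[F]ˣ) : 𝒪[F]) n
  rw [h₂, sub_self, mul_eq_zero] at h₃
  rcases h₃ with h₃ | h₃
  · ext
    simpa [sub_eq_zero] using h₃
  · have := congrArg (residue 𝒪[F]) h₃
    simp only [map_sum, map_pow, h₁, one_pow, Finset.sum_const, Finset.card_range, nsmul_eq_mul,
      mul_one, map_zero] at this
    exact absurd this (natCast_residueField_ne_zero F hn)

/-- Surjectivity comes from counting: by `ε` the field `F` has `n` roots of unity of order dividing
`n`, and the residue field has at most as many. -/
lemma bijective_restrictRootsOfUnity_residue {n : ℕ} [NeZero n] (hn : n ∣ Nat.card 𝓀[F] - 1)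
    (ε : rootsOfUnity n F ≃* rootsOfUnity n ℂ) :
    Function.Bijective (restrictRootsOfUnity (residue 𝒪[F]) n) := by
  have hinj := injective_restrictRootsOfUnity_residue (F := F) hn
  refine hinj.bijective_of_nat_card_le ?_
  rw [Nat.card_eq_of_bijective _ (bijective_restrictRootsOfUnity_algebraMap F n),
    Nat.card_congr ε.toEquiv, Complex.card_rootsOfUnity]
  exact card_rootsOfUnity _ _

/-- The inverse of reduction on `n`-th roots of unity. -/
noncomputable def teichmullerEquiv {n : ℕ} [NeZero n] (hn : n ∣ Nat.card 𝓀[F] - 1)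
    (ε : rootsOfUnity n F ≃* rootsOfUnity n ℂ) : rootsOfUnity n 𝓀[F] ≃* rootsOfUnity n F :=
  (MulEquiv.ofBijective _ (bijective_restrictRootsOfUnity_residue hn ε)).symm.trans
    (MulEquiv.ofBijective _ (bijective_restrictRootsOfUnity_algebraMap F n))

lemma valuation_sub_lt_one_iff_eq_teichmullerEquiv {n : ℕ} [NeZero n]
    (hn : n ∣ Nat.card 𝓀[F] - 1) (ε : rootsOfUnity n F ≃* rootsOfUnity n ℂ)
    (x : rootsOfUnity n 𝓀[F]) (y : 𝒪[F]) (hxy : residue 𝒪[F] y = (x : 𝓀[F]ˣ))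
    (ζ : rootsOfUnity n F) :
    valuation F (((ζ : Fˣ) : F) - y) < 1 ↔ ζ = teichmullerEquiv hn ε x := by
  obtain ⟨ξ, rfl⟩ := (bijective_restrictRootsOfUnity_algebraMap F n).2 ζ
  obtain ⟨η, rfl⟩ := (bijective_restrictRootsOfUnity_residue hn ε).2 x
  have h : teichmullerEquiv hn ε (restrictRootsOfUnity (residue 𝒪[F]) n η) =
      restrictRootsOfUnity (algebraMap 𝒪[F] F) n η := by
    simp only [teichmullerEquiv, MulEquiv.trans_apply]
    exact congrArg _ ((MulEquiv.symm_apply_eq _).2 rfl)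
  rw [h, (bijective_restrictRootsOfUnity_algebraMap F n).1.eq_iff,
    ← (injective_restrictRootsOfUnity_residue hn).eq_iff]
  have h₂ := residue_eq_iff_valuation_sub_lt_one ((ξ : 𝒪[F]ˣ) : 𝒪[F]) y
  rw [hxy] at h₂
  refine h₂.symm.trans ?_
  simp only [Subtype.ext_iff, Units.ext_iff]
  rfl

lemma pow_mem_rootsOfUnity_residueField {n : ℕ} (hn : n ∣ Nat.card 𝓀[F] - 1) (x : 𝓀[F]ˣ) :
    x ^ ((Nat.card 𝓀[F] - 1) / n) ∈ rootsOfUnity n 𝓀[F] := by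
  rw [mem_rootsOfUnity, ← pow_mul, Nat.div_mul_cancel hn, ← Nat.card_units,
    pow_card_eq_one']

/-- The character `x ↦ x ^ ((q - 1) / n)` of the residue field, with values carried to `ℂ` by the
lift of roots of unity to `F` followed by `ε`. -/
noncomputable def powerResidueChar {n : ℕ} [NeZero n] (hn : n ∣ Nat.card 𝓀[F] - 1)
    (ε : rootsOfUnity n F ≃* rootsOfUnity n ℂ) : MulChar 𝓀[F] ℂ :=
  MulChar.ofUnitHom <| (rootsOfUnity n ℂ).subtype.comp <| ε.toMonoidHom.comp <|
    (teichmullerEquiv hn ε).toMonoidHom.comp <|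
      (powMonoidHom ((Nat.card 𝓀[F] - 1) / n)).codRestrict (rootsOfUnity n 𝓀[F])
        (pow_mem_rootsOfUnity_residueField hn)

variable {n : ℕ} [NeZero n] (hn : n ∣ Nat.card 𝓀[F] - 1)
  (ε : rootsOfUnity n F ≃* rootsOfUnity n ℂ)

lemma powerResidueChar_coe (x : 𝓀[F]ˣ) :
    powerResidueChar hn ε x =
      ((ε (teichmullerEquiv hn ε ⟨_, pow_mem_rootsOfUnity_residueField hn x⟩) : ℂˣ) : ℂ) := by
  rw [powerResidueChar, MulChar.ofUnitHom_coe]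
  rfl

/-- On units `u`, the symbol `(u, p)_n` is the power residue character of the residue of `u`. -/
theorem coe_hilbertSymbol {p : 𝒪[F]} (hp : Irreducible p) (u : 𝒪[F])
    (hu : valuation F (u : F) = 1) :
    ((ε (hilbertSymbol n (u : F) (p : F)) : ℂˣ) : ℂ) =
      powerResidueChar hn ε (residue 𝒪[F] u) := by
  have hx := (residue_ne_zero_iff_valuation_eq_one u).2 hu
  obtain ⟨x, hx⟩ : ∃ x : 𝓀[F]ˣ, (x : 𝓀[F]) = residue 𝒪[F] u := ⟨Units.mk0 _ hx, rfl⟩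
  have key := valuation_sub_lt_one_iff_eq_teichmullerEquiv hn ε
    ⟨_, pow_mem_rootsOfUnity_residueField hn x⟩ (u ^ ((Nat.card 𝓀[F] - 1) / n)) (by simp [hx])
  have h := Classical.epsilon_spec (p := fun ζ : rootsOfUnity n F =>
    valuation F (((ζ : Fˣ) : F) - tameUnit (u : F) (p : F) ^ ((Nat.card 𝓀[F] - 1) / n)) < 1)
    ⟨_, by rw [tameUnit_uniformizer hu hp]; exact (key _).2 rfl⟩
  rw [← hx, powerResidueChar_coe]
  congr 3
  refine (key _).1 ?_
  simp only [tameUnit_uniformizer hu hp] at h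
  simp only [hilbertSymbol, tameUnit_uniformizer hu hp]
  exact h

/-- The power residue character has exact order `n`. -/
lemma powerResidueChar_pow_eq_one_iff (b : ℕ) : powerResidueChar hn ε ^ b = 1 ↔ n ∣ b := by
  have hm : 0 < (Nat.card 𝓀[F] - 1) / n := Nat.div_pos (Nat.le_of_dvd (by
    have := Finite.one_lt_card (α := 𝓀[F])
    omega) hn) (NeZero.pos n)
  rw [MulChar.eq_one_iff]
  have h₁ : ∀ x : 𝓀[F]ˣ, (powerResidueChar hn ε ^ b) x = 1 ↔
      x ^ ((Nat.card 𝓀[F] - 1) / n * b) = 1 := by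
    intro x
    rw [MulChar.pow_apply_coe, powerResidueChar_coe, ← Units.val_pow_eq_pow_val,
      Units.val_eq_one, ← SubgroupClass.coe_pow, OneMemClass.coe_eq_one, ← map_pow, ← map_pow,
      EmbeddingLike.map_eq_one_iff, EmbeddingLike.map_eq_one_iff, Subtype.ext_iff]
    simp [pow_mul]
  simp only [h₁]
  constructor
  · intro h
    obtain ⟨x, hx⟩ := IsCyclic.exists_generator (α := 𝓀[F]ˣ)
    have h₂ := orderOf_dvd_of_pow_eq_one (h x)
    rw [orderOf_eq_card_of_forall_mem_zpowers hx, Nat.card_units] at h₂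
    nth_rw 1 [← Nat.div_mul_cancel hn] at h₂
    exact Nat.dvd_of_mul_dvd_mul_left hm h₂
  · rintro ⟨c, rfl⟩ x
    rw [← mul_assoc, Nat.div_mul_cancel hn, pow_mul, ← Nat.card_units, pow_card_eq_one', one_pow]

lemma powerResidueChar_neg_one (hn2 : 2 * n ∣ Nat.card 𝓀[F] - 1) :
    powerResidueChar hn ε (-1) = 1 := by
  have h : Even ((Nat.card 𝓀[F] - 1) / n) := by
    obtain ⟨c, hc⟩ := hn2
    refine ⟨c, ?_⟩
    rw [hc, mul_comm 2 n, mul_assoc, Nat.mul_div_cancel_left _ (NeZero.pos n), two_mul]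
  have := powerResidueChar_coe hn ε (-1)
  rw [Units.val_neg, Units.val_one] at this
  rw [this]
  have h₂ : (⟨_, pow_mem_rootsOfUnity_residueField hn (-1)⟩ : rootsOfUnity n 𝓀[F]) = 1 :=
    Subtype.ext h.neg_one_pow
  rw [h₂, map_one, map_one]
  rfl

end hilbert

/-! ### The additive character of the residue field -/

section characters
variable {F : Type*} [Field F] [ValuativeRel F] [TopologicalSpace F]
  [IsNonarchimedeanLocalField F]

omit [TopologicalSpace F] [IsNonarchimedeanLocalField F] in
lemma eq_one_of_valuation_le_one {ψ₀ : AddChar F ℂ}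
    (hψ₀ : ∀ I : FractionalIdeal 𝒪[F]⁰ F, (∀ x ∈ I, ψ₀ x = 1) ↔ I ≤ 1) {x : F}
    (hx : valuation F x ≤ 1) : ψ₀ x = 1 :=
  (hψ₀ 1).2 le_rfl x ((FractionalIdeal.mem_one_iff _).2 ⟨⟨x, hx⟩, rfl⟩)

lemma map_inv_mul_congr {ψ₀ : AddChar F ℂ}
    (hψ₀ : ∀ I : FractionalIdeal 𝒪[F]⁰ F, (∀ x ∈ I, ψ₀ x = 1) ↔ I ≤ 1) {p : 𝒪[F]}
    (hp : Irreducible p) {x y : 𝒪[F]} (h : residue 𝒪[F] x = residue 𝒪[F] y) :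
    ψ₀ ((p : F)⁻¹ * x) = ψ₀ ((p : F)⁻¹ * y) := by
  have hp0 : (p : F) ≠ 0 := fun h => hp.ne_zero (Subtype.ext h)
  rw [← sub_eq_zero, ← map_sub, residue_eq_zero_iff,
    (IsDiscreteValuationRing.irreducible_iff_uniformizer p).1 hp, Ideal.mem_span_singleton] at h
  obtain ⟨c, hc⟩ := h
  have hxy : (x : F) = y + p * c := by
    have := congrArg (Subtype.val : 𝒪[F] → F) hc
    simpa [sub_eq_iff_eq_add'] using this
  rw [hxy, mul_add, inv_mul_cancel_left₀ hp0, AddChar.map_add_eq_mul,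
    eq_one_of_valuation_le_one hψ₀ c.2, mul_one]

/-- The additive character `x ↦ ψ₀ (x / p)` of the residue field, computed on arbitrary lifts. -/
noncomputable def residueAddChar (ψ₀ : AddChar F ℂ)
    (hψ₀ : ∀ I : FractionalIdeal 𝒪[F]⁰ F, (∀ x ∈ I, ψ₀ x = 1) ↔ I ≤ 1) {p : 𝒪[F]}
    (hp : Irreducible p) : AddChar 𝓀[F] ℂ where
  toFun x := ψ₀ ((p : F)⁻¹ * (Function.surjInv residue_surjective x : 𝒪[F]))
  map_zero_eq_one' := by
    rw [map_inv_mul_congr hψ₀ hp (y := 0) (by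
      rw [Function.surjInv_eq residue_surjective, map_zero])]
    simp
  map_add_eq_mul' x y := by
    rw [← AddChar.map_add_eq_mul, ← mul_add]
    exact map_inv_mul_congr hψ₀ hp (x := _) (y := _ + _) (by simp [Function.surjInv_eq])

variable {ψ₀ : AddChar F ℂ}
  (hψ₀ : ∀ I : FractionalIdeal 𝒪[F]⁰ F, (∀ x ∈ I, ψ₀ x = 1) ↔ I ≤ 1) {p : 𝒪[F]}
  (hp : Irreducible p)

lemma residueAddChar_residue (x : 𝒪[F]) :
    residueAddChar ψ₀ hψ₀ hp (residue 𝒪[F] x) = ψ₀ ((p : F)⁻¹ * x) :=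
  map_inv_mul_congr hψ₀ hp (Function.surjInv_eq _ _)

/-- This is the condition that `ψ₀` is not trivial on the larger fractional ideal `p⁻¹ 𝒪`. -/
lemma residueAddChar_ne_one : residueAddChar ψ₀ hψ₀ hp ≠ 1 := by
  intro h
  have hp0 : (p : F) ≠ 0 := fun h => hp.ne_zero (Subtype.ext h)
  have hI := (hψ₀ (FractionalIdeal.spanSingleton _ (p : F)⁻¹)).1 ?_
  · have h₁ := hI (FractionalIdeal.mem_spanSingleton_self _ _)
    obtain ⟨c, hc⟩ := (FractionalIdeal.mem_one_iff _).1 h₁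
    refine hp.not_isUnit (IsUnit.of_mul_eq_one c (Subtype.ext ?_))
    change (p : F) * c = 1
    change (c : F) = _ at hc
    rw [hc, mul_inv_cancel₀ hp0]
  · intro x hx
    obtain ⟨c, rfl⟩ := (FractionalIdeal.mem_spanSingleton _).1 hx
    have := residueAddChar_residue hψ₀ hp c
    rw [h, AddChar.one_apply, mul_comm] at this
    exact this.symm

end characters

/-! ### Values of the Gauss sums -/

section gauss
variable {F : Type*} [Field F] [ValuativeRel F] [TopologicalSpace F]
  [IsNonarchimedeanLocalField F] [MeasurableSpace F] [BorelSpace F]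

variable {n : ℕ} [NeZero n] (hn : n ∣ Nat.card 𝓀[F] - 1)
  (ε : rootsOfUnity n F ≃* rootsOfUnity n ℂ) {ψ₀ : AddChar F ℂ}
  (hψ₀ : ∀ I : FractionalIdeal 𝒪[F]⁰ F, (∀ x ∈ I, ψ₀ x = 1) ↔ I ≤ 1) {p : 𝒪[F]}
  (hp : Irreducible p)

theorem gaussG_eq_gaussSum (b : ℕ) :
    gaussG n ε ψ₀ (p : F) b = (Nat.card 𝓀[F] : ℂ)⁻¹ *
      gaussSum (powerResidueChar hn ε ^ b) (residueAddChar ψ₀ hψ₀ hp) := by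
  refine setIntegral_units _ _ (fun u hu => ?_) (by simp [MulChar.map_zero])
  rw [coe_hilbertSymbol hn ε hp u hu, residueAddChar_residue, sub_sub_cancel_left, zpow_neg_one,
    zpow_natCast]
  have hx := (residue_ne_zero_iff_valuation_eq_one u).2 hu
  obtain ⟨x, hx⟩ : ∃ x : 𝓀[F]ˣ, (x : 𝓀[F]) = residue 𝒪[F] u := ⟨Units.mk0 _ hx, rfl⟩
  rw [← hx, MulChar.pow_apply_coe]

include hn hψ₀ hp in
theorem gaussH_eq (b : ℕ) :
    gaussH n ε ψ₀ (p : F) b = if n ∣ b then 1 - (Nat.card 𝓀[F] : ℂ)⁻¹ else 0 := by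
  have h : gaussH n ε ψ₀ (p : F) b =
      (Nat.card 𝓀[F] : ℂ)⁻¹ * ∑ x, (powerResidueChar hn ε ^ b) x := by
    refine setIntegral_units _ _ (fun u hu => ?_) (by simp [MulChar.map_zero])
    rw [coe_hilbertSymbol hn ε hp u hu, sub_self, zpow_zero, one_mul,
      eq_one_of_valuation_le_one hψ₀ u.2, mul_one, zpow_natCast]
    have hx := (residue_ne_zero_iff_valuation_eq_one u).2 hu
    obtain ⟨x, hx⟩ : ∃ x : 𝓀[F]ˣ, (x : 𝓀[F]) = residue 𝒪[F] u := ⟨Units.mk0 _ hx, rfl⟩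
    rw [← hx, MulChar.pow_apply_coe]
  rw [h]
  split_ifs with hb
  · classical
    rw [(powerResidueChar_pow_eq_one_iff hn ε b).2 hb, MulChar.sum_one_eq_card_units,
      Fintype.card_units, ← Nat.card_eq_fintype_card, Nat.cast_sub Nat.card_pos, mul_sub,
      inv_mul_cancel₀ (Nat.cast_ne_zero.2 Nat.card_pos.ne')]
    simp
  · rw [MulChar.sum_eq_zero_of_ne_one fun h => hb ((powerResidueChar_pow_eq_one_iff hn ε b).1 h),
      mul_zero]

include hn hψ₀ hp in
theorem gaussG_congr {b c : ℕ} (h : (b : ZMod n) = c) :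
    gaussG n ε ψ₀ (p : F) b = gaussG n ε ψ₀ (p : F) c := by
  rw [gaussG_eq_gaussSum hn ε hψ₀ hp, gaussG_eq_gaussSum hn ε hψ₀ hp]
  have h₁ := (powerResidueChar_pow_eq_one_iff hn ε n).2 dvd_rfl
  rw [pow_eq_pow_mod b h₁, pow_eq_pow_mod c h₁, (ZMod.natCast_eq_natCast_iff' b c n).1 h]

include hn hψ₀ hp in
theorem gaussG_of_dvd {b : ℕ} (h : n ∣ b) :
    gaussG n ε ψ₀ (p : F) b = -(Nat.card 𝓀[F] : ℂ)⁻¹ := by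
  rw [gaussG_eq_gaussSum hn ε hψ₀ hp, (powerResidueChar_pow_eq_one_iff hn ε b).2 h,
    gaussSum_one_left (residueAddChar_ne_one hψ₀ hp), mul_neg_one]

include hψ₀ hp in
theorem gaussG_mul_gaussG (hn2 : 2 * n ∣ Nat.card 𝓀[F] - 1) {b c : ℕ} (hb : ¬ n ∣ b)
    (hbc : n ∣ b + c) :
    gaussG n ε ψ₀ (p : F) b * gaussG n ε ψ₀ (p : F) c = (Nat.card 𝓀[F] : ℂ)⁻¹ := by
  have hn : n ∣ Nat.card 𝓀[F] - 1 := (dvd_mul_left n 2).trans hn2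
  set χ := powerResidueChar hn ε with hχ
  have h₁ : χ ^ c = (χ ^ b)⁻¹ := by
    rw [eq_inv_iff_mul_eq_one, ← pow_add, add_comm,
      powerResidueChar_pow_eq_one_iff hn ε (b + c)]
    exact hbc
  have h₂ : (χ ^ b)⁻¹ (-1) = 1 := by
    have h := MulChar.pow_apply_coe χ b (-1 : 𝓀[F]ˣ)
    rw [Units.val_neg, Units.val_one, powerResidueChar_neg_one hn ε hn2, one_pow] at h
    rw [MulChar.inv_apply', inv_neg_one, h]
  -- The formula involves `ψ⁻¹`; replacing it by `ψ` costs the value of the character at `-1`.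
  have h₃ := gaussSum_mul_gaussSum_eq_card
    (fun h => hb ((powerResidueChar_pow_eq_one_iff hn ε b).1 h))
    (AddChar.IsPrimitive.of_ne_one (residueAddChar_ne_one hψ₀ hp))
  rw [gaussG_eq_gaussSum hn ε hψ₀ hp, gaussG_eq_gaussSum hn ε hψ₀ hp, ← hχ, h₁,
    ← mul_gaussSum_inv_eq_gaussSum (χ ^ b)⁻¹, h₂, one_mul, mul_mul_mul_comm, h₃,
    ← Nat.card_eq_fintype_card, mul_assoc, inv_mul_cancel₀ (Nat.cast_ne_zero.2 Nat.card_pos.ne'),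
    mul_one]

end gauss

end MetaplecticIce

theorem theorem5p1 {F : Type*} [Field F] [ValuativeRel F] [TopologicalSpace F]
    [IsNonarchimedeanLocalField F] [MeasurableSpace F] [BorelSpace F]
    (n : ℕ) (hn : 0 < n) (hq : 2 * n ∣ Nat.card 𝓀[F] - 1)
    (ε : rootsOfUnity n F ≃* rootsOfUnity n ℂ)
    (ψ₀ : AddChar F ℂ)
    (hψ₀ : ∀ I : FractionalIdeal 𝒪[F]⁰ F, (∀ x ∈ I, ψ₀ x = 1) ↔ I ≤ 1)
    (p : 𝒪[F]) (hp : Irreducible p)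
    (z₁ z₂ : ℂ) (N : ℕ) :
    (∀ α γ : ColSpins N,
      twoLayerZ (gammaIce (gaussG n ε ψ₀ p) (gaussH n ε ψ₀ p) z₁)
          (deltaIce (gaussG n ε ψ₀ p) (gaussH n ε ψ₀ p) z₂) α γ =
        twoLayerZ (deltaIce (gaussG n ε ψ₀ p) (gaussH n ε ψ₀ p) z₂)
          (gammaIce (gaussG n ε ψ₀ p) (gaussH n ε ψ₀ p) z₁) α γ) ∧
    transferMatrix (N := N) (gammaIce (gaussG n ε ψ₀ p) (gaussH n ε ψ₀ p) z₁) *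
        transferMatrix (deltaIce (gaussG n ε ψ₀ p) (gaussH n ε ψ₀ p) z₂) =
      transferMatrix (deltaIce (gaussG n ε ψ₀ p) (gaussH n ε ψ₀ p) z₂) *
        transferMatrix (gammaIce (gaussG n ε ψ₀ p) (gaussH n ε ψ₀ p) z₁) := by
  have : NeZero n := ⟨hn.ne'⟩
  have hn' : n ∣ Nat.card 𝓀[F] - 1 := (dvd_mul_left n 2).trans hq
  have key : ∀ α γ : ColSpins N,
      twoLayerZ (gammaIce (gaussG n ε ψ₀ p) (gaussH n ε ψ₀ p) z₁)
          (deltaIce (gaussG n ε ψ₀ p) (gaussH n ε ψ₀ p) z₂) α γ =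
        twoLayerZ (deltaIce (gaussG n ε ψ₀ p) (gaussH n ε ψ₀ p) z₂)
          (gammaIce (gaussG n ε ψ₀ p) (gaussH n ε ψ₀ p) z₁) α γ := by
    refine twoLayerZ_gammaIce_deltaIce_comm (n := n) _ _ (Nat.card 𝓀[F] : ℂ)⁻¹ z₁ z₂
      (fun c => gaussG n ε ψ₀ p c.val) (fun a => ?_) (fun a => ?_) ?_ fun c hc => ?_
    · exact gaussG_congr hn' ε hψ₀ hp (by simp)
    · simp only [gaussH_eq hn' ε hψ₀ hp, ZMod.natCast_eq_zero_iff]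
    · exact gaussG_of_dvd hn' ε hψ₀ hp (by simp)
    · refine gaussG_mul_gaussG ε hψ₀ hp hq (fun h => hc ?_) ?_
      · simpa using (ZMod.natCast_eq_zero_iff _ _).2 h
      · rw [← ZMod.natCast_eq_zero_iff]
        simp
  refine ⟨key, ?_⟩
  ext α γ
  rw [← twoLayerZ_eq_mul, ← twoLayerZ_eq_mul, key]
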